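/- Let $q=1$ and let $V$ be a finite set, or let $q\ge 2$ be a prime power and let $V$ be a finite-dimensional vector space over the field $\mathbb{F}_q$ with $q$ elements. "Subspaces" of $V$ are subsets of $V$ if $q=1$ and linear subspaces if $q\ge 2$; the rank $\operatorname{rk}$ is the cardinality, respectively the dimension. For a subspace $A$ of $V$ let $\binom{A}{k}$ denote the set of subspaces of $A$ of rank $k$, and put $[m]_q=1+q+\dots+q^{m-1}$. For $f:\binom{A}{k}\to\mathbb{R}$ with $0\le k\le \operatorname{rk}A$ and for $0\le i\le\min(k,\operatorname{rk}A-k)$, let $\bar V_i$ be the space of all functions of the form $K\mapsto\sum_{I\in\binom{K}{i}}w(I)$ on $\binom{A}{k}$, with $w:\binom{A}{i}\to\mathbb{R}$. For such $i$, the function $w$ is uniquely determined by its image in $\bar V_i$. If $f\in \bar V_i$ is the image of $w$, then $w=:\mathrm{wt}^{(i)}_f$ is called the $i$-weight distribution of $f$. The degree $\deg_A(f)$ is the smallest $i\in\{0,\dots,\min(k,\operatorname{rk}A-k)\}$ with $f\in\bar V_i$ if $f\ne 0$, and $\deg_A(0)=-\infty$. **Theorem.** Let $n=\operatorname{rk}V\ge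 1$, let $H$ be a subspace of $V$ of rank $n-1$, and let $0\le k\le n-1$. Then the map $$\Psi:\mathbb{R}^{\binom{H}{k}}\to\mathbb{R}^{\binom{V}{k}},\qquad \Psi(f)(K)=\begin{cases}f(K)&\text{if }K\le H,\\0&\text{if }K\nleq H,\end{cases}$$ is $\mathbb{R}$-linear and injective, its image is $\{g\in\mathbb{R}^{\binom{V}{k}} : \operatorname{supp} g\subseteq\binom{H}{k}\}$, and for all $f:\binom{H}{k}\to\mathbb{R}$ $$\deg_V(\Psi(f))=\min(\deg_H(f)+1,\;k).$$ Moreover, for all $f:\binom{H}{k}\to\mathbb{R}$ and all integers $e$ with $\max(\deg_H(f),0)+1\le e\le\min(k,n-k)$, the $(e-1)$-weight distribution of $f$ (with respect to $H$) and the $e$-weight distribution of $\Psi(f)$ (with respect to $V$) exist and are unique, and for all $E\in\binom{V}{e}$ $$\mathrm{wt}^{(e)}_{\Psi(f)}(E)=\begin{cases}\displaystyle\frac{1}{[k-e+1]_q}\sum_{E'\in\binom{E}{e-1}}\mathrm{wt}^{(e-1)}_f(E')&\text{if }E\le H,\\[3mm]\displaystyle-\frac{[k-e]_q}{q^{k-e}\,[k-e+1]_q}\;\mathrm{wt}^{(e-1)}_f(E\cap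 H)&\text{if }E\nleq H.\end{cases}$$ -/

import Mathlib

noncomputable section

/-- A type whose elements have a rank. It is used for the lattice of all subsets of a finite set
(the case `q = 1`) and for the lattice of all subspaces of a finite vector space over `𝔽_q`. -/
class HasRk (L : Type*) where
  /-- The rank of an element. -/
  rk : L → ℕ

/-- In the set case the rank of a subset is its cardinality. -/
instance instHasRkFinset (X : Type*) : HasRk (Finset X) :=
  ⟨fun S => S.card⟩

/-- In the vector space case the rank of a subspace is its dimension. -/
instance instHasRkSubmodule (F V : Type*) [Field F] [AddCommGroup V] [Module F V] :
    HasRk (Submodule F V) :=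
  ⟨fun U => Module.finrank F U⟩

/-- `Subspaces A k` is the set of all elements `K ≤ A` of rank `k`, i.e. the `k`-subspaces of the
ambient space `A`. -/
def Subspaces {L : Type*} [LE L] [HasRk L] (A : L) (k : ℕ) : Type _ :=
  {K : L // K ≤ A ∧ HasRk.rk K = k}

instance instFiniteSubspaces {L : Type*} [LE L] [HasRk L] [Finite L] (A : L) (k : ℕ) :
    Finite (Subspaces A k) :=
  inferInstanceAs (Finite {K : L // K ≤ A ∧ HasRk.rk K = k})

instance instFintypeSubspaces {L : Type*} [LE L] [HasRk L] [Finite L] (A : L) (k : ℕ) :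
    Fintype (Subspaces A k) :=
  Fintype.ofFinite _

/-- For `E ≤ A`, a `k`-subspace of `E` regarded as a `k`-subspace of `A`. -/
def Subspaces.incl {L : Type*} [Preorder L] [HasRk L] {E A : L} (h : E ≤ A) {k : ℕ}
    (K : Subspaces E k) : Subspaces A k :=
  ⟨K.1, K.2.1.trans h, K.2.2⟩

open Classical in
/-- The `i`-vs.-`k` incidence matrix of the ambient space `A`. -/
def incidence {L : Type*} [LE L] [HasRk L] (A : L) (i k : ℕ) :
    Matrix (Subspaces A i) (Subspaces A k) ℝ :=
  Matrix.of fun I K => if I.1 ≤ K.1 then 1 else 0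

/-- The linear map described by the transposed incidence matrix: it sends `w` to the function
`K ↦ ∑ w I`, the sum being over all `i`-subspaces `I ≤ K`; in other words, to the linear
combination of `i`-pencils with coefficients `w`. -/
def upMap {L : Type*} [LE L] [HasRk L] [Finite L] (A : L) (i k : ℕ) :
    (Subspaces A i → ℝ) →ₗ[ℝ] (Subspaces A k → ℝ) :=
  (incidence A i k).transpose.mulVecLin

/-- The row space of the incidence matrix: the span of the `i`-pencils in the space of all real
functions on the `k`-subspaces of `A`. -/
def pencilSpan {L : Type*} [LE L] [HasRk L] [Finite L] (A : L) (i k : ℕ) :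
    Submodule ℝ (Subspaces A k → ℝ) :=
  LinearMap.range (upMap A i k)

open Classical in
/-- The degree, with respect to the ambient space `A`, of a function `f` on the `k`-subspaces of
`A` (where `k ≤ rk A`): it is `-∞` (written `⊥`) for `f = 0`, and otherwise the smallest
`t ∈ {0, …, min (k, rk A - k)}` such that `f` is a linear combination of `t`-pencils. -/
def degree {L : Type*} [LE L] [HasRk L] [Finite L] (A : L) {k : ℕ} (f : Subspaces A k → ℝ) :
    WithBot ℕ :=
  if f = 0 then ⊥
  else ((sInf {t : ℕ | t ≤ min k (HasRk.rk A - k) ∧ f ∈ pencilSpan A t k} : ℕ) : WithBot ℕ)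

/-- The `i`-weight distribution of `f`: the coefficients in a representation of `f` as a linear
combination of `i`-pencils (meaningful when there is exactly one such representation). -/
def wt {L : Type*} [LE L] [HasRk L] [Finite L] (A : L) {k : ℕ} (i : ℕ)
    (f : Subspaces A k → ℝ) : Subspaces A i → ℝ :=
  Function.invFun (upMap A i k) f

/-- The `q`-analog `1 + q + ⋯ + q ^ (m - 1)` of the natural number `m`. -/
def qNumber (q : ℝ) (m : ℕ) : ℝ :=
  ∑ i ∈ Finset.range m, q ^ i

open Classical in
/-- Extension by zero of a function on the `k`-subspaces of `H` to the `k`-subspaces of the whole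
space. -/
def extendByZero {L : Type*} [LE L] [OrderTop L] [HasRk L] (H : L) (k : ℕ)
    (f : Subspaces H k → ℝ) : Subspaces (⊤ : L) k → ℝ :=
  fun K => if h : K.1 ≤ H then f ⟨K.1, h, K.2.2⟩ else 0

end

/-! ### Ranks and cover counts in the common lattice setting. -/

noncomputable section

open HasRk Finset

/-! Sets and vector spaces are treated at once: only a modular rank and the number `[m]_q` of covers
in an interval are used. Two double counts carry everything. Upper bound and weights: summing
`i`-pencil sums over the `(i + 1)`-subspaces of `K` multiplies by `[rk K - i]_q`
(`pencilSum_pencilSum`). With the stated weights this reproduces `f` below `H`; on a `K` not below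
`H`, the `E ≤ K ⊓ H` and the transversal `E` cancel. Lower bound: suppose a combination of `(s +
1)`-pencils vanishes off `H`. Summing it over the `(m + 1)`-subspaces through `K' ≤ H` that are not
below `H` (`sum_pencilSum_not_le`) expresses its `(s + 1)`-pencil sum at `K'` by an `s`-pencil sum.
Injectivity of the pencil map on `H` turns this into a formula for the weights, so the restriction
to `H` is a combination of `s`-pencils. The same argument, by induction on the rank, proves that
injectivity. Together with the symmetry of Gaussian binomials it shows that every function has a
degree. -/

/-- The common properties of the lattice of subsets of a finite set (`q = 1`) and of the lattice
of subspaces of a finite vector space over `𝔽_q`: a lattice graded by a modular rank function in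
which an interval of length `m` has `[m]_q` atoms. -/
structure IsGeometry (L : Type*) [Lattice L] [OrderBot L] [HasRk L] (q : ℝ) : Prop where
  one_le : 1 ≤ q
  rk_bot : rk (⊥ : L) = 0
  rk_lt : ∀ {a b : L}, a < b → rk a < rk b
  rk_sup_add : ∀ a b : L, rk (a ⊔ b) + rk (a ⊓ b) = rk a + rk b
  card_covers : ∀ {a b : L}, a ≤ b →
    (Nat.card {c : L // a ≤ c ∧ c ≤ b ∧ rk c = rk a + 1} : ℝ) = qNumber q (rk b - rk a)

lemma qNumber_succ (q : ℝ) (m : ℕ) : qNumber q (m + 1) = qNumber q m + q ^ m := by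
  simp [qNumber, sum_range_succ]

lemma qNumber_add (q : ℝ) (m l : ℕ) : qNumber q (m + l) = qNumber q m + q ^ m * qNumber q l := by
  simp [qNumber, sum_range_add, pow_add, mul_sum]

lemma qNumber_pos {q : ℝ} (hq : 1 ≤ q) {m : ℕ} (hm : 0 < m) : 0 < qNumber q m :=
  sum_pos (fun i _ => by positivity) ⟨0, by simpa using hm⟩

open Classical in
/-- The sum of `w` over all `i`-subspaces of `K`. -/
def pencilSum {L : Type*} [LE L] [HasRk L] [Fintype L] (i : ℕ) (w : L → ℝ) (K : L) : ℝ :=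
  ∑ I with I ≤ K ∧ rk I = i, w I

namespace IsGeometry

variable {L : Type*} [Lattice L] [OrderBot L] [HasRk L] {q : ℝ}

lemma q_pos (h : IsGeometry L q) : 0 < q := zero_lt_one.trans_le h.one_le

lemma rk_mono (h : IsGeometry L q) {a b : L} (hab : a ≤ b) : rk a ≤ rk b := by
  rcases hab.eq_or_lt with rfl | hlt
  · exact le_rfl
  · exact (h.rk_lt hlt).le

lemma eq_of_le_of_rk_le (h : IsGeometry L q) {a b : L} (hab : a ≤ b) (hr : rk b ≤ rk a) :
    a = b := by
  rcases hab.eq_or_lt with rfl | hlt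
  · rfl
  · exact absurd (h.rk_lt hlt) (by omega)

lemma rk_eq_zero (h : IsGeometry L q) {a : L} : rk a = 0 ↔ a = ⊥ := by
  constructor
  · intro ha
    exact (h.eq_of_le_of_rk_le bot_le (by omega)).symm
  · rintro rfl
    exact h.rk_bot

/-- An element that is not below a hyperplane `H` of `A` meets `H` in a hyperplane. -/
lemma rk_inf_add_one (h : IsGeometry L q) {A H K : L} (hHA : H ≤ A) (hr : rk A = rk H + 1)
    (hKA : K ≤ A) (hKH : ¬ K ≤ H) : rk (K ⊓ H) + 1 = rk K := by
  have h1 := h.rk_sup_add K H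
  have h2 : rk H < rk (K ⊔ H) := h.rk_lt (right_lt_sup.2 hKH)
  have h3 : rk (K ⊔ H) ≤ rk A := h.rk_mono (sup_le hKA hHA)
  omega

lemma exists_cover (h : IsGeometry L q) {a b : L} (hab : a ≤ b) (hr : rk a < rk b) :
    ∃ c, a ≤ c ∧ c ≤ b ∧ rk c = rk a + 1 := by
  have h1 := h.card_covers hab
  have h2 := qNumber_pos h.one_le (Nat.sub_pos_of_lt hr)
  rw [← h1, Nat.cast_pos, Nat.card_pos_iff] at h2
  obtain ⟨⟨c, hc⟩⟩ := h2.1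
  exact ⟨c, hc⟩

lemma exists_between (h : IsGeometry L q) {a b : L} (hab : a ≤ b) {m : ℕ} (ham : rk a ≤ m)
    (hmb : m ≤ rk b) : ∃ c, a ≤ c ∧ c ≤ b ∧ rk c = m := by
  induction m, ham using Nat.le_induction with
  | base => exact ⟨a, le_rfl, hab, rfl⟩
  | succ m hm ih =>
    obtain ⟨c, h1, h2, h3⟩ := ih (by omega)
    obtain ⟨d, h4, h5, h6⟩ := h.exists_cover h2 (by omega)
    exact ⟨d, h1.trans h4, h5, by omega⟩

/-- There are elements of `A` of every positive rank that are not below the hyperplane `H`. -/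
lemma exists_not_le (h : IsGeometry L q) {A H : L} (hHA : H ≤ A) (hr : rk A = rk H + 1) {k : ℕ}
    (hk : 0 < k) (hkA : k ≤ rk A) : ∃ K, K ≤ A ∧ rk K = k ∧ ¬ K ≤ H := by
  obtain ⟨K', -, h1, h2⟩ := h.exists_between (bot_le (a := H)) (m := k - 1)
    (by rw [h.rk_bot]; omega) (by omega)
  have h3 := h.card_covers (h1.trans hHA)
  have h4 := h.card_covers h1
  -- Otherwise `K'` would have the same covers in `A` as in `H`, but `[r + 1]_q` and `[r]_q` differ
  -- by `q ^ r`.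
  by_contra! hcon
  have h5 : ∀ c, (K' ≤ c ∧ c ≤ A ∧ rk c = rk K' + 1) ↔ (K' ≤ c ∧ c ≤ H ∧ rk c = rk K' + 1) :=
    fun c => ⟨fun hc => ⟨hc.1, hcon c hc.2.1 (by omega), hc.2.2⟩,
      fun hc => ⟨hc.1, hc.2.1.trans hHA, hc.2.2⟩⟩
  rw [Nat.card_congr (Equiv.subtypeEquivRight h5), h4,
    show rk A - rk K' = rk H - rk K' + 1 by omega, qNumber_succ] at h3
  have := pow_pos h.q_pos (rk H - rk K')
  linarith

variable [Fintype L]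

open Classical in
lemma card_filter_covers (h : IsGeometry L q) {a b : L} (hab : a ≤ b) {m : ℕ}
    (hm : m = rk a + 1) :
    (#{c : L | a ≤ c ∧ c ≤ b ∧ rk c = m} : ℝ) = qNumber q (rk b - rk a) := by
  subst hm
  rw [← h.card_covers hab, Nat.card_eq_fintype_card, Fintype.card_subtype]

open Classical in
/-- The number of covers of `a` below `K` that are not below the hyperplane `H`. -/
lemma card_filter_covers_not_le (h : IsGeometry L q) {A H K a : L} (hHA : H ≤ A)
    (hr : rk A = rk H + 1) (hKA : K ≤ A) (hKH : ¬ K ≤ H) (haK : a ≤ K) (haH : a ≤ H) {m : ℕ}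
    (hm : m = rk a + 1) :
    (#{c : L | (a ≤ c ∧ c ≤ K ∧ rk c = m) ∧ ¬ c ≤ H} : ℝ) = q ^ (rk K - m) := by
  have h1 := h.card_filter_covers haK hm
  have h2 := h.card_filter_covers (le_inf haK haH) hm
  have h3 := h.rk_inf_add_one hHA hr hKA hKH
  have h4 := h.rk_mono (le_inf haK haH)
  have h5 := card_filter_add_card_filter_not (s := {c : L | a ≤ c ∧ c ≤ K ∧ rk c = m})
    (fun c => c ≤ H)
  rw [filter_filter, filter_filter] at h5
  -- The covers to be discarded lie below `K ⊓ H`, of rank one less than `K`; what remains is `[r +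
  -- 1]_q - [r]_q = q ^ r`.
  have h6 : ({c : L | (a ≤ c ∧ c ≤ K ∧ rk c = m) ∧ c ≤ H} : Finset L) =
      ({c : L | a ≤ c ∧ c ≤ K ⊓ H ∧ rk c = m} : Finset L) := by
    ext c
    simp only [mem_filter, mem_univ, true_and, le_inf_iff]
    tauto
  rw [h6] at h5
  rw [show rk K - rk a = (rk (K ⊓ H) - rk a) + 1 by omega, qNumber_succ, ← h2, ← h5] at h1
  push_cast at h1
  rw [show rk K - m = rk (K ⊓ H) - rk a by omega]
  linarith

/-! ### Pencil sums and double counting. -/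

lemma pencilSum_self (h : IsGeometry L q) (w : L → ℝ) {i : ℕ} {K : L} (hK : rk K = i) :
    pencilSum i w K = w K := by
  rw [pencilSum, sum_eq_single_of_mem K (by simp [hK])]
  intro I hI hne
  simp only [mem_filter, mem_univ, true_and] at hI
  exact absurd (h.eq_of_le_of_rk_le hI.1 (by omega)) hne

lemma pencilSum_zero (h : IsGeometry L q) (w : L → ℝ) (K : L) : pencilSum 0 w K = w ⊥ := by
  rw [pencilSum, sum_eq_single_of_mem ⊥ (by simp [h.rk_bot])]
  intro I hI hne
  simp only [mem_filter, mem_univ, true_and] at hI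
  exact absurd (h.rk_eq_zero.1 hI.2) hne

omit [OrderBot L] in
lemma _root_.pencilSum_congr {i : ℕ} {w w' : L → ℝ} {K : L}
    (hw : ∀ I, I ≤ K → rk I = i → w I = w' I) : pencilSum i w K = pencilSum i w' K := by
  refine sum_congr rfl fun I hI => ?_
  simp only [mem_filter, mem_univ, true_and] at hI
  exact hw I hI.1 hI.2

omit [OrderBot L] in
lemma _root_.pencilSum_const_mul (i : ℕ) (c : ℝ) (w : L → ℝ) (K : L) :
    pencilSum i (fun I => c * w I) K = c * pencilSum i w K := by
  simp only [pencilSum, mul_sum]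

/-- Exchange the sums over `I ≤ E ≤ K`: each `I` of rank `i` has `[rk K - i]_q` covers below `K`. -/
lemma pencilSum_pencilSum (h : IsGeometry L q) (i : ℕ) (w : L → ℝ) (K : L) :
    pencilSum (i + 1) (pencilSum i w) K = qNumber q (rk K - i) * pencilSum i w K := by
  classical
  unfold pencilSum
  rw [sum_comm' (t' := {I | I ≤ K ∧ rk I = i})
    (s' := fun I => {E | I ≤ E ∧ E ≤ K ∧ rk E = i + 1}), mul_sum]
  · refine sum_congr rfl fun I hI => ?_
    simp only [mem_filter, mem_univ, true_and] at hI
    rw [sum_const, nsmul_eq_mul, h.card_filter_covers hI.1 (by rw [hI.2]), hI.2]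
  · intro E I
    simp only [mem_filter, mem_univ, true_and]
    constructor
    · rintro ⟨⟨h1, h2⟩, h3, h4⟩
      exact ⟨⟨h3, h1, h2⟩, h3.trans h1, h4⟩
    · rintro ⟨⟨h1, h2, h3⟩, h4, h5⟩
      exact ⟨⟨h2, h3⟩, h1, h5⟩

omit [OrderBot L] in
open Classical in
lemma _root_.pencilSum_eq_inf_add (i : ℕ) (w : L → ℝ) (K H : L) :
    pencilSum i w K =
      pencilSum i w (K ⊓ H) + ∑ I with (I ≤ K ∧ rk I = i) ∧ ¬ I ≤ H, w I := by
  unfold pencilSum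
  rw [← sum_filter_add_sum_filter_not _ (fun I => I ≤ H), filter_filter, filter_filter]
  congr 2
  ext c
  simp only [mem_filter, mem_univ, true_and, le_inf_iff]
  tauto

/-! ### Verification of the weight formula. -/

open Classical in
/-- The weights of the extension by zero. -/
def _root_.extensionWeight (q : ℝ) (H : L) (k e : ℕ) (w : L → ℝ) (E : L) : ℝ :=
  if E ≤ H then 1 / qNumber q (k - e + 1) * pencilSum (e - 1) w E
  else -(qNumber q (k - e) / (q ^ (k - e) * qNumber q (k - e + 1))) * w (E ⊓ H)

omit [OrderBot L] in
lemma _root_.extensionWeight_of_le {H E : L} (hE : E ≤ H) (q : ℝ) (k e : ℕ) (w : L → ℝ) :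
    extensionWeight q H k e w E = 1 / qNumber q (k - e + 1) * pencilSum (e - 1) w E :=
  if_pos hE

omit [OrderBot L] in
lemma _root_.extensionWeight_of_not_le {H E : L} (hE : ¬ E ≤ H) (q : ℝ) (k e : ℕ) (w : L → ℝ) :
    extensionWeight q H k e w E =
      -(qNumber q (k - e) / (q ^ (k - e) * qNumber q (k - e + 1))) * w (E ⊓ H) :=
  if_neg hE

/-- The factor `1 / [k - e + 1]_q` cancels the multiplicity from `pencilSum_pencilSum`. -/
lemma pencilSum_extensionWeight_of_le (h : IsGeometry L q) {H K : L} {k e : ℕ} (he : 1 ≤ e)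
    (hek : e ≤ k) (w : L → ℝ) (hK : rk K = k) (hKH : K ≤ H) :
    pencilSum e (extensionWeight q H k e w) K = pencilSum (e - 1) w K := by
  rw [pencilSum_congr (w' := fun E => 1 / qNumber q (k - e + 1) * pencilSum (e - 1) w E)
    (fun E hE _ => extensionWeight_of_le (hE.trans hKH) ..), pencilSum_const_mul]
  have h1 := h.pencilSum_pencilSum (e - 1) w K
  rw [Nat.sub_add_cancel he, hK, show k - (e - 1) = k - e + 1 by omega] at h1
  have h2 := qNumber_pos h.one_le (Nat.succ_pos (k - e))
  rw [h1]
  field_simp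

/-- With `S` the `(e - 1)`-pencil sum of `w` at `K ⊓ H`, the `E ≤ H` contribute `[k - e]_q / [k - e
+ 1]_q * S`, since `K ⊓ H` has rank `k - 1`; the other `E` contribute the negative of this. -/
lemma pencilSum_extensionWeight_of_not_le (h : IsGeometry L q) {A H K : L} (hHA : H ≤ A)
    (hr : rk A = rk H + 1) {k e : ℕ} (he : 1 ≤ e)
    (hek : e ≤ k) (w : L → ℝ) (hK : rk K = k) (hKA : K ≤ A) (hKH : ¬ K ≤ H) :
    pencilSum e (extensionWeight q H k e w) K = 0 := by
  classical
  have h0 := h.rk_inf_add_one hHA hr hKA hKH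
  have hpos := qNumber_pos h.one_le (Nat.succ_pos (k - e))
  have hq := pow_pos h.q_pos (k - e)
  rw [pencilSum_eq_inf_add _ _ K H,
    pencilSum_congr (w' := fun E => 1 / qNumber q (k - e + 1) * pencilSum (e - 1) w E)
    (fun E hE _ => extensionWeight_of_le (hE.trans inf_le_right) ..), pencilSum_const_mul]
  have h1 := h.pencilSum_pencilSum (e - 1) w (K ⊓ H)
  rw [Nat.sub_add_cancel he, show rk (K ⊓ H) - (e - 1) = k - e by omega] at h1
  -- Group the transversal `I` by `J = I ⊓ H`: the fibre over `J` consists of the covers of `J` in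
  -- `K` not below `H`, and there are `q ^ (k - e)` of them.
  have h2 : ∑ I with (I ≤ K ∧ rk I = e) ∧ ¬ I ≤ H, w (I ⊓ H) =
      q ^ (k - e) * pencilSum (e - 1) w (K ⊓ H) := by
    unfold pencilSum
    rw [mul_sum, ← sum_fiberwise_of_maps_to (g := fun I => I ⊓ H)
      (t := {J | J ≤ K ⊓ H ∧ rk J = e - 1})]
    · refine sum_congr rfl fun J hJ => ?_
      simp only [mem_filter, mem_univ, true_and, le_inf_iff] at hJ
      rw [sum_congr rfl (g := fun _ => w J)
        (by intro I hI; rw [(mem_filter.1 hI).2]), sum_const, nsmul_eq_mul, filter_filter]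
      have h3 := h.card_filter_covers_not_le hHA hr hKA hKH hJ.1.1 hJ.1.2 (m := e) (by omega)
      rw [hK] at h3
      rw [← h3]
      congr 3
      ext I
      simp only [mem_filter, mem_univ, true_and]
      constructor
      · rintro ⟨⟨⟨h4, h5⟩, h6⟩, h7⟩
        exact ⟨⟨h7 ▸ inf_le_left, h4, h5⟩, h6⟩
      · rintro ⟨⟨h4, h5, h6⟩, h7⟩
        have h8 := h.rk_inf_add_one hHA hr (h5.trans hKA) h7
        exact ⟨⟨⟨h5, h6⟩, h7⟩,
          (h.eq_of_le_of_rk_le (le_inf h4 hJ.1.2) (by omega)).symm⟩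
    · intro I hI
      simp only [mem_filter, mem_univ, true_and] at hI ⊢
      have h8 := h.rk_inf_add_one hHA hr (hI.1.1.trans hKA) hI.2
      exact ⟨inf_le_inf_right H hI.1.1, by omega⟩
  rw [h1, sum_congr rfl (g := fun I =>
    -(qNumber q (k - e) / (q ^ (k - e) * qNumber q (k - e + 1))) * w (I ⊓ H))
    (fun I hI => extensionWeight_of_not_le (mem_filter.1 hI).2.2 ..), ← mul_sum, h2]
  field_simp
  ring

/-! ### Summation across a hyperplane and injectivity. -/

open Classical in
/-- For a hyperplane `H` of `A`, the sum of `w` over the `t`-subspaces `I` of `A`, not below `H`,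
that meet `H` in `J`. -/
def _root_.transversalSum (A H : L) (t : ℕ) (w : L → ℝ) (J : L) : ℝ :=
  ∑ I with (I ≤ A ∧ rk I = t) ∧ ¬ I ≤ H ∧ I ⊓ H = J, w I

open Classical in
/-- Averaging a combination of `(s + 1)`-pencils over the `(m + 1)`-subspaces through `K'` that
are not below the hyperplane `H`. -/
lemma sum_pencilSum_not_le (h : IsGeometry L q) {A H K' : L} (hHA : H ≤ A)
    (hr : rk A = rk H + 1) {s m : ℕ} (w : L → ℝ) (hK : rk K' = m) (hKH : K' ≤ H) :
    ∑ K with (K' ≤ K ∧ K ≤ A ∧ rk K = m + 1) ∧ ¬ K ≤ H, pencilSum (s + 1) w K =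
      q ^ (rk H - m) * pencilSum (s + 1) w K' +
        pencilSum s (transversalSum A H (s + 1) w) K' := by
  have hAH : ¬ A ≤ H := fun hle => by have := h.rk_mono hle; omega
  have key : ∀ K, K' ≤ K → K ≤ A → rk K = m + 1 → ¬ K ≤ H → K ⊓ H = K' := by
    intro K h1 h2 h3 h4
    have h5 := h.rk_inf_add_one hHA hr h2 h4
    exact (h.eq_of_le_of_rk_le (le_inf h1 hKH) (by omega)).symm
  rw [sum_congr rfl (g := fun K => pencilSum (s + 1) w K' +
    ∑ I with (I ≤ K ∧ rk I = s + 1) ∧ ¬ I ≤ H, w I), sum_add_distrib, sum_const, nsmul_eq_mul,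
    h.card_filter_covers_not_le hHA hr le_rfl hAH (hKH.trans hHA) hKH (by omega)]
  · congr 1
    · congr 2
      omega
    · unfold pencilSum transversalSum
      -- A transversal `I` determines both `K = I ⊔ K'` and `J = I ⊓ H`, so both double sums run
      -- once over the `I` with `I ⊓ H ≤ K'`.
      rw [sum_comm' (t' := {I | (I ≤ A ∧ rk I = s + 1) ∧ ¬ I ≤ H ∧ I ⊓ H ≤ K'})
        (s' := fun I => {I ⊔ K'}), sum_comm' (s := {J | J ≤ K' ∧ rk J = s})
        (t' := {I | (I ≤ A ∧ rk I = s + 1) ∧ ¬ I ≤ H ∧ I ⊓ H ≤ K'})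
        (s' := fun I => {I ⊓ H})]
      · simp
      · intro J I
        simp only [mem_filter, mem_univ, true_and, mem_singleton]
        constructor
        · rintro ⟨⟨h1, h2⟩, h3, h4, rfl⟩
          exact ⟨rfl, h3, h4, h1⟩
        · rintro ⟨rfl, h3, h4, h1⟩
          have := h.rk_inf_add_one hHA hr h3.1 h4
          exact ⟨⟨h1, by omega⟩, h3, h4, rfl⟩
      · intro K I
        simp only [mem_filter, mem_univ, true_and, mem_singleton]
        constructor
        · rintro ⟨⟨⟨h1, h2, h3⟩, h4⟩, ⟨h5, h6⟩, h7⟩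
          have h8 : I ⊓ H ≤ K' := key K h1 h2 h3 h4 ▸ inf_le_inf_right H h5
          refine ⟨?_, ⟨h5.trans h2, h6⟩, h7, h8⟩
          refine (h.eq_of_le_of_rk_le (sup_le h5 h1) ?_).symm
          have h9 : rk K' < rk (I ⊔ K') :=
            h.rk_lt (right_lt_sup.2 fun hle => h7 (hle.trans hKH))
          omega
        · rintro ⟨rfl, ⟨h1, h2⟩, h3, h4⟩
          have h5 := h.rk_sup_add I K'
          have h6 := h.rk_inf_add_one hHA hr h1 h3
          have h7 : I ⊓ K' = I ⊓ H :=
            le_antisymm (inf_le_inf_left I hKH) (le_inf inf_le_left h4)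
          rw [h7] at h5
          exact ⟨⟨⟨le_sup_right, sup_le h1 (hKH.trans hHA), by omega⟩,
            fun hle => h3 (le_sup_left.trans hle)⟩, ⟨le_sup_left, h2⟩, h3⟩
  · intro K hK
    simp only [mem_filter, mem_univ, true_and] at hK
    rw [pencilSum_eq_inf_add _ _ K H, key K hK.1.1 hK.1.2.1 hK.1.2.2 hK.2]

/-- The pencils of `i`-subspaces are linearly independent on the `k`-subspaces of `A`. -/
def _root_.PencilInjective (A : L) (i k : ℕ) : Prop :=
  ∀ w : L → ℝ, (∀ K, K ≤ A → rk K = k → pencilSum i w K = 0) → ∀ I, I ≤ A → rk I = i → w I = 0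

/-- If a combination of `(s + 1)`-pencils vanishes on all `(m + 1)`-subspaces of `A` that are not
below the hyperplane `H`, then its weights below `H` come from a weight on `s`-subspaces. -/
lemma eq_pencilSum_transversalSum (h : IsGeometry L q) {A H : L} (hHA : H ≤ A)
    (hr : rk A = rk H + 1) {s m : ℕ} (hsm : s < m) (hinj : PencilInjective H (s + 1) m)
    (w : L → ℝ) (hw : ∀ K, K ≤ A → rk K = m + 1 → ¬ K ≤ H → pencilSum (s + 1) w K = 0)
    {I : L} (hI : I ≤ H) (hIr : rk I = s + 1) :
    w I = -(1 / (q ^ (rk H - m) * qNumber q (m - s))) *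
      pencilSum s (transversalSum A H (s + 1) w) I := by
  have hq := pow_pos h.q_pos (rk H - m)
  have hm := qNumber_pos h.one_le (Nat.sub_pos_of_lt hsm)
  -- The difference of the two sides has vanishing pencil sums on all `m`-subspaces of `H`, hence is
  -- zero by injectivity.
  have h1 := hinj (fun I => w I - (-(1 / (q ^ (rk H - m) * qNumber q (m - s))) *
      pencilSum s (transversalSum A H (s + 1) w) I)) ?_ I hI hIr
  · linarith
  intro K' hK' hKr
  have h2 := h.sum_pencilSum_not_le hHA hr (s := s) w hKr hK'
  rw [sum_eq_zero] at h2
  · have h3 := h.pencilSum_pencilSum s (transversalSum A H (s + 1) w) K'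
    have h4 : ∀ u v : L → ℝ, pencilSum (s + 1) (fun I => u I - v I) K' =
        pencilSum (s + 1) u K' - pencilSum (s + 1) v K' :=
      fun u v => sum_sub_distrib ..
    rw [h4, pencilSum_const_mul, h3, hKr]
    field_simp
    linarith
  · intro K hK
    simp only [mem_filter, mem_univ, true_and] at hK
    exact hw K hK.1.2.1 hK.1.2.2 hK.2

/-- Insert the formula for the weights below `H` and double count once more, now in rank `m + 1`. -/
lemma pencilSum_eq_mul_pencilSum_transversalSum (h : IsGeometry L q) {A H : L} (hHA : H ≤ A)
    (hr : rk A = rk H + 1) {s m : ℕ} (hsm : s < m) (hinj : PencilInjective H (s + 1) m)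
    (w : L → ℝ) (hw : ∀ K, K ≤ A → rk K = m + 1 → ¬ K ≤ H → pencilSum (s + 1) w K = 0)
    {K : L} (hK : K ≤ H) (hKr : rk K = m + 1) :
    pencilSum (s + 1) w K = -(qNumber q (m + 1 - s) / (q ^ (rk H - m) * qNumber q (m - s))) *
      pencilSum s (transversalSum A H (s + 1) w) K := by
  rw [pencilSum_congr (fun I hI hIr =>
    h.eq_pencilSum_transversalSum hHA hr hsm hinj w hw (hI.trans hK) hIr),
    pencilSum_const_mul, h.pencilSum_pencilSum, hKr]
  ring

/-- Kantor's theorem: the incidence matrices have full row rank. -/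
theorem pencilInjective (h : IsGeometry L q) (A : L) {i k : ℕ} (hik : i ≤ k)
    (hA : i + k ≤ rk A) : PencilInjective A i k := by
  induction hn : rk A generalizing A i k with
  | zero =>
    intro w hw I hI hIr
    rw [← h.pencilSum_self w hIr]
    exact hw I hI (by omega)
  | succ n ih =>
    intro w hw I hI hIr
    rcases hik.eq_or_lt with rfl | hlt
    · rw [← h.pencilSum_self w hIr]
      exact hw I hI hIr
    rcases i with _ | s
    · obtain ⟨K, -, h1, h2⟩ := h.exists_between (bot_le (a := A)) (m := k)
        (by rw [h.rk_bot]; omega) (by omega)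
      rw [h.rk_eq_zero.1 hIr, ← h.pencilSum_zero w K]
      exact hw K h1 h2
    obtain ⟨m, rfl⟩ : ∃ m, k = m + 1 := ⟨k - 1, by omega⟩
    -- The hyperplane is taken through the given `I`, so that the formula for weights below `H`
    -- applies to `w I`.
    obtain ⟨H, h1, h2, h3⟩ := h.exists_between hI (m := n) (by omega) (by omega)
    have hr : rk A = rk H + 1 := by omega
    have hsm : s < m := by omega
    have hinj : PencilInjective H (s + 1) m := ih H (by omega) (by omega) h3
    have hinj' : PencilInjective H s (m + 1) := ih H (by omega) (by omega) h3
    have hw' : ∀ K, K ≤ A → rk K = m + 1 → ¬ K ≤ H → pencilSum (s + 1) w K = 0 :=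
      fun K hK hKr _ => hw K hK hKr
    have hq := pow_pos h.q_pos (rk H - m)
    have hm := qNumber_pos h.one_le (Nat.sub_pos_of_lt hsm)
    have hm' := qNumber_pos h.one_le (show 0 < m + 1 - s by omega)
    -- On `(m + 1)`-subspaces of `H` the vanishing sum is a nonzero multiple of the `s`-pencil sum
    -- of the transversal sums, so these vanish as well.
    have hz := hinj' (transversalSum A H (s + 1) w) fun K hK hKr => by
      have h4 := h.pencilSum_eq_mul_pencilSum_transversalSum h2 hr hsm hinj w hw' hK hKr
      rw [hw K (hK.trans h2) hKr, eq_comm, mul_eq_zero, neg_eq_zero] at h4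
      exact h4.resolve_left (by positivity)
    rw [h.eq_pencilSum_transversalSum h2 hr hsm hinj w hw' h1 hIr,
      pencilSum_congr (w' := fun _ => 0) fun J hJ hJr => hz J (hJ.trans h1) hJr]
    simp [pencilSum]

/-! ### Symmetry of the Gaussian binomial coefficients. -/

open Classical in
/-- The `q`-analog of Pascal's rule. -/
lemma card_succ (h : IsGeometry L q) {A H : L} (hHA : H ≤ A) (hr : rk A = rk H + 1) (k : ℕ) :
    (#{K : L | K ≤ A ∧ rk K = k + 1} : ℝ) =
      #{K : L | K ≤ H ∧ rk K = k + 1} + q ^ (rk H - k) * #{K : L | K ≤ H ∧ rk K = k} := by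
  have hAH : ¬ A ≤ H := fun hle => by have := h.rk_mono hle; omega
  have h1 := pencilSum_eq_inf_add (k + 1) (fun _ : L => (1 : ℝ)) A H
  simp only [pencilSum, inf_eq_right.2 hHA, sum_const, nsmul_eq_mul, mul_one] at h1
  rw [h1]
  congr 1
  rw [card_eq_sum_card_fiberwise (f := fun K => K ⊓ H) (t := {K : L | K ≤ H ∧ rk K = k}),
    Nat.cast_sum, sum_congr rfl (g := fun _ => q ^ (rk H - k)), sum_const, nsmul_eq_mul, mul_comm]
  · intro J hJ
    simp only [mem_filter, mem_univ, true_and] at hJ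
    have h2 := h.card_filter_covers_not_le hHA hr le_rfl hAH (hJ.1.trans hHA) hJ.1
      (m := k + 1) (by omega)
    rw [show rk A - (k + 1) = rk H - k by omega] at h2
    rw [← h2, filter_filter]
    congr 2
    ext I
    simp only [mem_filter, mem_univ, true_and]
    constructor
    · rintro ⟨⟨⟨h4, h5⟩, h6⟩, h7⟩
      exact ⟨⟨h7 ▸ inf_le_left, h4, h5⟩, h6⟩
    · rintro ⟨⟨h4, h5, h6⟩, h7⟩
      have h8 := h.rk_inf_add_one hHA hr h5 h7
      exact ⟨⟨⟨h5, h6⟩, h7⟩, (h.eq_of_le_of_rk_le (le_inf h4 hJ.1) (by omega)).symm⟩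
  · intro I hI
    simp only [coe_filter, Set.mem_ofPred_eq, mem_univ, true_and] at hI ⊢
    have h8 := h.rk_inf_add_one hHA hr hI.1.1 hI.2
    exact ⟨inf_le_right, by omega⟩

/-- The `q`-analog of the factorial. -/
def _root_.qFactorial (q : ℝ) (n : ℕ) : ℝ :=
  ∏ i ∈ range n, qNumber q (i + 1)

lemma _root_.qFactorial_succ (q : ℝ) (n : ℕ) :
    qFactorial q (n + 1) = qFactorial q n * qNumber q (n + 1) := prod_range_succ ..

lemma _root_.qFactorial_pos {q : ℝ} (hq : 1 ≤ q) (n : ℕ) : 0 < qFactorial q n :=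
  prod_pos fun _ _ => qNumber_pos hq (Nat.succ_pos _)

-- Induction along a hyperplane by Pascal's rule. The product form avoids division and is visibly
-- symmetric in `k` and `l`.
open Classical in
lemma card_mul_qFactorial (h : IsGeometry L q) (A : L) {k l : ℕ} (hkl : k + l = rk A) :
    #{K : L | K ≤ A ∧ rk K = k} * (qFactorial q k * qFactorial q l) = qFactorial q (rk A) := by
  induction hn : rk A generalizing A k l with
  | zero =>
    obtain ⟨rfl, rfl⟩ : k = 0 ∧ l = 0 := by omega
    rw [h.rk_eq_zero] at hn
    have h1 : ({K : L | K ≤ A ∧ rk K = 0} : Finset L) = {⊥} := by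
      ext K
      simp only [mem_filter, mem_univ, true_and, mem_singleton, h.rk_eq_zero]
      exact ⟨fun hK => hK.2, fun hK => ⟨hK ▸ bot_le, hK⟩⟩
    simp [h1, qFactorial]
  | succ n ih =>
    rcases k with _ | k
    · have h1 : ({K : L | K ≤ A ∧ rk K = 0} : Finset L) = {⊥} := by
        ext K
        simp only [mem_filter, mem_univ, true_and, mem_singleton, h.rk_eq_zero]
        exact ⟨fun hK => hK.2, fun hK => ⟨hK ▸ bot_le, hK⟩⟩
      rw [h1, ← hn, ← hkl]
      simp [qFactorial]
    obtain ⟨H, -, hHA, hH⟩ := h.exists_between (bot_le (a := A)) (m := n)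
      (by rw [h.rk_bot]; omega) (by omega)
    rw [h.card_succ hHA (by omega), hH]
    have h2 := ih H (k := k) (l := l) (by omega) hH
    rcases l with _ | l
    · have h3 : ({K : L | K ≤ H ∧ rk K = k + 1} : Finset L) = ∅ := by
        ext K
        simp only [mem_filter, mem_univ, true_and, notMem_empty, iff_false]
        rintro ⟨h4, h5⟩
        have := h.rk_mono h4
        omega
      rw [h3, qFactorial_succ, qFactorial_succ, ← h2]
      obtain rfl : k = n := by omega
      simp
      ring
    · have h3 := ih H (k := k + 1) (l := l) (by omega) hH
      -- The splitting `[n + 1] = [l + 1] + q ^ (l + 1) * [k + 1]` matches the two terms of Pascal's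
      -- rule.
      rw [qFactorial_succ q n, show n + 1 = (l + 1) + (k + 1) by omega,
        show n - k = l + 1 by omega, qNumber_add, mul_add]
      nth_rewrite 1 [← h3]
      rw [← h2, qFactorial_succ q k, qFactorial_succ q l]
      ring

open Classical in
lemma card_eq_card (h : IsGeometry L q) (A : L) {k l : ℕ} (hkl : k + l = rk A) :
    #{K : L | K ≤ A ∧ rk K = k} = #{K : L | K ≤ A ∧ rk K = l} := by
  have h1 := h.card_mul_qFactorial A hkl
  have h2 := h.card_mul_qFactorial A ((add_comm l k).trans hkl)
  have h3 := qFactorial_pos h.one_le k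
  have h4 := qFactorial_pos h.one_le l
  rw [← h1, mul_comm (qFactorial q l)] at h2
  exact_mod_cast (mul_right_cancel₀ (by positivity) h2).symm

end IsGeometry

/-! ### Weights as functions on the whole lattice. -/

section

variable {L : Type*} [Lattice L] [HasRk L] [Fintype L]

/-- Letting weights live on all of `L` allows passing between `A`, `H` and `K` without changing
types. -/
lemma upMap_restrict_apply (A : L) (i k : ℕ) (v : L → ℝ) (K : Subspaces A k) :
    upMap A i k (fun I => v I.1) K = pencilSum i v K.1 := by
  classical
  have h1 : upMap A i k (fun I => v I.1) K =
      ∑ I : Subspaces A i, if I.1 ≤ K.1 then v I.1 else 0 := by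
    refine sum_congr rfl fun I _ => ?_
    change (if I.1 ≤ K.1 then 1 else 0) * v I.1 = _
    rw [ite_mul, one_mul, zero_mul]
  have h2 := sum_subtype (F := instFintypeSubspaces A i) ({I : L | I ≤ A ∧ rk I = i} : Finset L)
    (p := fun I => I ≤ A ∧ rk I = i) (by simp) (fun I => if I ≤ K.1 then v I else 0)
  rw [h1]
  refine h2.symm.trans ?_
  rw [← sum_filter, filter_filter, pencilSum]
  refine sum_congr ?_ fun _ _ => rfl
  ext I
  simp only [mem_filter, mem_univ, true_and]
  exact ⟨fun h => ⟨h.2, h.1.2⟩, fun h => ⟨⟨h.1.trans K.2.1, h.2⟩, h.1⟩⟩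

lemma sum_subspaces (A : L) (i : ℕ) (v : L → ℝ) :
    ∑ I : Subspaces A i, v I.1 = pencilSum i v A :=
  (sum_subtype (F := instFintypeSubspaces A i) _ (p := fun I => I ≤ A ∧ rk I = i)
    (by simp) v).symm

omit [Fintype L] in
lemma exists_restrict_eq {A : L} {i : ℕ} (w : Subspaces A i → ℝ) :
    ∃ v : L → ℝ, (fun I : Subspaces A i => v I.1) = w := by
  classical
  exact ⟨fun I => if h : I ≤ A ∧ rk I = i then w ⟨I, h⟩ else 0, funext fun I => dif_pos I.2⟩

lemma mem_pencilSpan_iff {A : L} {i k : ℕ} {f : Subspaces A k → ℝ} :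
    f ∈ pencilSpan A i k ↔ ∃ v : L → ℝ, ∀ K, f K = pencilSum i v K.1 := by
  constructor
  · rintro ⟨w, rfl⟩
    obtain ⟨v, rfl⟩ := exists_restrict_eq w
    exact ⟨v, upMap_restrict_apply A i k v⟩
  · rintro ⟨v, hv⟩
    exact ⟨fun I => v I.1, funext fun K => (upMap_restrict_apply A i k v K).trans (hv K).symm⟩

lemma wt_upMap {A : L} {i k : ℕ} (hinj : Function.Injective (upMap A i k))
    (w : Subspaces A i → ℝ) : wt A i (upMap A i k w) = w :=
  Function.leftInverse_invFun hinj w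

end

/-! ### Extension by zero: linearity, injectivity and image. -/

section

variable {L : Type*} [Lattice L] [HasRk L] [OrderTop L]

lemma extendByZero_apply_of_le {H : L} {k : ℕ} (f : Subspaces H k → ℝ)
    {K : Subspaces (⊤ : L) k} (h : K.1 ≤ H) : extendByZero H k f K = f ⟨K.1, h, K.2.2⟩ :=
  dif_pos h

lemma extendByZero_apply_of_not_le {H : L} {k : ℕ} (f : Subspaces H k → ℝ)
    {K : Subspaces (⊤ : L) k} (h : ¬ K.1 ≤ H) : extendByZero H k f K = 0 :=
  dif_neg h

lemma isLinearMap_extendByZero (H : L) (k : ℕ) : IsLinearMap ℝ (extendByZero H k) := by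
  constructor
  · intro f g
    ext K
    change _ = extendByZero H k f K + extendByZero H k g K
    by_cases h : K.1 ≤ H
    · simp only [extendByZero_apply_of_le _ h]
      rfl
    · simp only [extendByZero_apply_of_not_le _ h, add_zero]
  · intro c f
    ext K
    change _ = c * extendByZero H k f K
    by_cases h : K.1 ≤ H
    · simp only [extendByZero_apply_of_le _ h]
      rfl
    · simp only [extendByZero_apply_of_not_le _ h, mul_zero]

lemma extendByZero_apply_incl {H : L} {k : ℕ} (f : Subspaces H k → ℝ) (K : Subspaces H k) :
    extendByZero H k f (K.incl le_top) = f K :=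
  dif_pos K.2.1

lemma extendByZero_injective (H : L) (k : ℕ) : Function.Injective (extendByZero H k) := by
  intro f g hfg
  ext K
  rw [← extendByZero_apply_incl f K, hfg, extendByZero_apply_incl]

lemma range_extendByZero (H : L) (k : ℕ) :
    Set.range (extendByZero H k) =
      {g : Subspaces (⊤ : L) k → ℝ | Function.support g ⊆ {K | K.1 ≤ H}} := by
  ext g
  constructor
  · rintro ⟨f, rfl⟩ K hK
    by_contra h
    exact hK (extendByZero_apply_of_not_le f h)
  · intro hg
    refine ⟨fun K => g ⟨K.1, le_top, K.2.2⟩, funext fun K => ?_⟩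
    by_cases h : K.1 ≤ H
    · exact extendByZero_apply_of_le _ h
    · rw [extendByZero_apply_of_not_le _ h]
      by_contra hne
      exact h (hg (Ne.symm hne))

end

/-! ### Degrees and weight distributions. -/

namespace IsGeometry

variable {L : Type*} [Lattice L] [OrderBot L] [HasRk L] [Fintype L] {q : ℝ}

lemma upMap_injective (h : IsGeometry L q) (A : L) {i k : ℕ} (hik : i ≤ k) (hA : i + k ≤ rk A) :
    Function.Injective (upMap A i k) := by
  rw [injective_iff_map_eq_zero]
  intro w hw
  obtain ⟨v, rfl⟩ := exists_restrict_eq w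
  ext I
  refine h.pencilInjective A hik hA v (fun K hK hKr => ?_) I.1 I.2.1 I.2.2
  rw [← upMap_restrict_apply A i k v ⟨K, hK, hKr⟩, hw]
  rfl

lemma mem_pencilSpan_self (h : IsGeometry L q) {A : L} {k : ℕ} (f : Subspaces A k → ℝ) :
    f ∈ pencilSpan A k k := by
  obtain ⟨v, rfl⟩ := exists_restrict_eq f
  exact mem_pencilSpan_iff.2 ⟨v, fun K => (h.pencilSum_self v K.2.2).symm⟩

/-- By `pencilSum_pencilSum`, a `j`-pencil combination is a `(j + 1)`-pencil combination after
division by `[k - j]_q`, which is nonzero for `j < k`. -/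
lemma pencilSpan_mono (h : IsGeometry L q) (A : L) {i j k : ℕ} (hij : i ≤ j) (hjk : j ≤ k) :
    pencilSpan A i k ≤ pencilSpan A j k := by
  induction j, hij using Nat.le_induction with
  | base => exact le_rfl
  | succ j hij ih =>
    refine (ih (by omega)).trans fun f hf => ?_
    obtain ⟨v, hv⟩ := mem_pencilSpan_iff.1 hf
    refine mem_pencilSpan_iff.2 ⟨fun I => 1 / qNumber q (k - j) * pencilSum j v I, fun K => ?_⟩
    have h1 := qNumber_pos h.one_le (Nat.sub_pos_of_lt hjk)
    rw [pencilSum_const_mul, h.pencilSum_pencilSum, K.2.2, hv K]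
    field_simp

lemma card_subspaces_eq (h : IsGeometry L q) (A : L) {k l : ℕ} (hkl : k + l = rk A) :
    Fintype.card (Subspaces A k) = Fintype.card (Subspaces A l) := by
  classical
  have h1 := sum_subspaces A k (fun _ => 1)
  have h2 := sum_subspaces A l (fun _ => 1)
  have h3 := h.card_eq_card A hkl
  simp only [pencilSum, sum_const, nsmul_eq_mul, mul_one, card_univ] at h1 h2
  exact_mod_cast h1.trans ((congrArg _ h3).trans h2.symm)

/-- If `k` exceeds `rk A - k`, the pencil map is injective between spaces of equal dimension, hence
onto. -/
lemma pencilSpan_eq_top (h : IsGeometry L q) (A : L) {k : ℕ} (hk : k ≤ rk A) :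
    pencilSpan A (min k (rk A - k)) k = ⊤ := by
  rcases le_total k (rk A - k) with hle | hle
  · rw [min_eq_left hle, eq_top_iff]
    exact fun f _ => h.mem_pencilSpan_self f
  · rw [min_eq_right hle]
    refine LinearMap.range_eq_top.2 ?_
    rw [← LinearMap.injective_iff_surjective_of_finrank_eq_finrank]
    · exact h.upMap_injective A hle (by omega)
    · rw [Module.finrank_fintype_fun_eq_card, Module.finrank_fintype_fun_eq_card]
      exact h.card_subspaces_eq A (by omega)

omit [OrderBot L] in
lemma degree_zero_fun {A : L} {k : ℕ} : degree A (0 : Subspaces A k → ℝ) = ⊥ := if_pos rfl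

/-- The set of admissible `t` contains `min k (rk A - k)`, so `sInf` is a true minimum and not the
default value `0`. -/
lemma exists_degree_eq (h : IsGeometry L q) {A : L} {k : ℕ} (hk : k ≤ rk A)
    {f : Subspaces A k → ℝ} (hf : f ≠ 0) :
    ∃ d : ℕ, degree A f = d ∧ d ≤ min k (rk A - k) ∧ f ∈ pencilSpan A d k ∧
      ∀ t ≤ min k (rk A - k), f ∈ pencilSpan A t k → d ≤ t := by
  have h1 : {t : ℕ | t ≤ min k (rk A - k) ∧ f ∈ pencilSpan A t k}.Nonempty :=
    ⟨_, le_rfl, by rw [h.pencilSpan_eq_top A hk]; trivial⟩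
  exact ⟨_, if_neg hf, (Nat.sInf_mem h1).1, (Nat.sInf_mem h1).2,
    fun t ht hft => Nat.sInf_le ⟨ht, hft⟩⟩

variable [OrderTop L] {H : L} {k : ℕ}

/-- The extension by zero of a combination of `(e - 1)`-pencils is a combination of
`e`-pencils. -/
lemma upMap_extensionWeight (h : IsGeometry L q) (hr : rk (⊤ : L) = rk H + 1) {e : ℕ}
    (he : 1 ≤ e) (hek : e ≤ k) (v : L → ℝ) :
    upMap ⊤ e k (fun E => extensionWeight q H k e v E.1) =
      extendByZero H k (upMap H (e - 1) k fun I => v I.1) := by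
  ext K
  rw [upMap_restrict_apply]
  by_cases hK : K.1 ≤ H
  · rw [extendByZero_apply_of_le _ hK, h.pencilSum_extensionWeight_of_le he hek v K.2.2 hK]
    exact (upMap_restrict_apply H (e - 1) k v ⟨K.1, hK, K.2.2⟩).symm
  · rw [extendByZero_apply_of_not_le _ hK,
      h.pencilSum_extensionWeight_of_not_le le_top hr he hek v K.2.2 le_top hK]

lemma extendByZero_mem_pencilSpan (h : IsGeometry L q) (hr : rk (⊤ : L) = rk H + 1) {d : ℕ}
    (hdk : d + 1 ≤ k) {f : Subspaces H k → ℝ} (hf : f ∈ pencilSpan H d k) :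
    extendByZero H k f ∈ pencilSpan ⊤ (d + 1) k := by
  obtain ⟨w, rfl⟩ := hf
  obtain ⟨v, rfl⟩ := exists_restrict_eq w
  exact ⟨_, h.upMap_extensionWeight hr (Nat.succ_pos d) hdk v⟩

/-- If the extension by zero of `f` is a combination of `(s + 1)`-pencils, then `f` is a
combination of `s`-pencils. -/
lemma mem_pencilSpan_of_extendByZero_mem (h : IsGeometry L q) (hr : rk (⊤ : L) = rk H + 1)
    {s : ℕ} (hsk : s + 1 < k) (hsH : s + k ≤ rk H) {f : Subspaces H k → ℝ}
    (hf : extendByZero H k f ∈ pencilSpan ⊤ (s + 1) k) : f ∈ pencilSpan H s k := by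
  obtain ⟨m, rfl⟩ : ∃ m, k = m + 1 := ⟨k - 1, by omega⟩
  obtain ⟨v, hv⟩ := mem_pencilSpan_iff.1 hf
  refine mem_pencilSpan_iff.2 ⟨fun I => -(qNumber q (m + 1 - s) /
    (q ^ (rk H - m) * qNumber q (m - s))) * transversalSum ⊤ H (s + 1) v I, fun K => ?_⟩
  rw [pencilSum_const_mul, ← h.pencilSum_eq_mul_pencilSum_transversalSum le_top hr
    (show s < m by omega) (h.pencilInjective H (by omega) (by omega)) v _ K.2.1 K.2.2]
  · exact (extendByZero_apply_incl f K).symm.trans (hv _)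
  · intro K' _ hKr hKH
    exact (hv ⟨K', le_top, hKr⟩).symm.trans (extendByZero_apply_of_not_le f hKH)

/-- Combinations of `0`-pencils are constant, and the extension vanishes at some `k`-subspace not
below `H`. -/
lemma eq_zero_of_extendByZero_mem (h : IsGeometry L q) (hr : rk (⊤ : L) = rk H + 1)
    (hk : 0 < k) (hkH : k ≤ rk H) {f : Subspaces H k → ℝ}
    (hf : extendByZero H k f ∈ pencilSpan ⊤ 0 k) : f = 0 := by
  obtain ⟨v, hv⟩ := mem_pencilSpan_iff.1 hf
  obtain ⟨K', -, hKr, hKH⟩ := h.exists_not_le (le_top (a := H)) hr hk (by omega)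
  have h1 := (extendByZero_apply_of_not_le f hKH).symm.trans (hv ⟨K', le_top, hKr⟩)
  rw [h.pencilSum_zero] at h1
  ext K
  rw [← extendByZero_apply_incl f K, hv, h.pencilSum_zero, ← h1]
  rfl

theorem degree_extendByZero (h : IsGeometry L q) (hr : rk (⊤ : L) = rk H + 1) (hk : k ≤ rk H)
    (f : Subspaces H k → ℝ) :
    degree ⊤ (extendByZero H k f) = min (degree H f + 1) (k : WithBot ℕ) := by
  by_cases hf : f = 0
  · subst hf
    rw [(isLinearMap_extendByZero H k).map_zero, degree_zero_fun, degree_zero_fun]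
    simp
  have hf' : extendByZero H k f ≠ 0 := fun h0 =>
    hf (extendByZero_injective H k (h0.trans (isLinearMap_extendByZero H k).map_zero.symm))
  obtain ⟨d, hd, hd1, hd2, hd3⟩ := h.exists_degree_eq hk hf
  obtain ⟨t, ht, ht1, ht2, ht3⟩ := h.exists_degree_eq (by omega) hf'
  rw [hd, ht, show ((d : WithBot ℕ) + 1) = ((d + 1 : ℕ) : WithBot ℕ) by push_cast; rfl]
  suffices t = min (d + 1) k by rw [this]; exact_mod_cast rfl
  refine le_antisymm ?_ ?_
  · refine ht3 _ (by omega) ?_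
    rcases le_or_gt (d + 1) k with hdk | hdk
    · rw [min_eq_left hdk]
      exact h.extendByZero_mem_pencilSpan hr hdk hd2
    · rw [min_eq_right hdk.le]
      exact h.mem_pencilSpan_self _
  · by_contra! hlt
    -- For `t = s + 1`, the function `f` would be a combination of `s`-pencils with `s < d`, against
    -- minimality of `d`.
    rcases t with _ | s
    · exact hf (h.eq_zero_of_extendByZero_mem hr (by omega) hk ht2)
    · have := hd3 s (by omega)
        (h.mem_pencilSpan_of_extendByZero_mem hr (by omega) (by omega) ht2)
      omega

theorem wt_extendByZero (h : IsGeometry L q) (hr : rk (⊤ : L) = rk H + 1) (hk : k ≤ rk H)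
    (f : Subspaces H k → ℝ) {e : ℕ} (hde : max (degree H f) 0 + 1 ≤ (e : WithBot ℕ))
    (he : e ≤ min k (rk (⊤ : L) - k)) :
    (∃! w, upMap H (e - 1) k w = f) ∧
    (∃! w, upMap ⊤ e k w = extendByZero H k f) ∧
    ∀ E : Subspaces (⊤ : L) e,
      (∀ hE : E.1 ≤ H, wt ⊤ e (extendByZero H k f) E =
        1 / qNumber q (k - e + 1) *
          ∑ E' : Subspaces E.1 (e - 1), wt H (e - 1) f (E'.incl hE)) ∧
      (¬ E.1 ≤ H → ∃ E' : Subspaces H (e - 1), E'.1 = E.1 ⊓ H ∧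
        wt ⊤ e (extendByZero H k f) E =
          -(qNumber q (k - e) / (q ^ (k - e) * qNumber q (k - e + 1))) *
            wt H (e - 1) f E') := by
  -- The maximum with `0` matters for `f = 0`, where `degree H f + 1` is still `⊥`; it keeps `e - 1`
  -- from truncating.
  have he1 : 1 ≤ e := by
    have h1 : (0 : WithBot ℕ) + 1 ≤ e := (add_le_add_left (le_max_right _ _) 1).trans hde
    exact_mod_cast h1
  have hmem : f ∈ pencilSpan H (e - 1) k := by
    by_cases hf : f = 0
    · rw [hf]
      exact Submodule.zero_mem _
    obtain ⟨d, hd, -, hd2, -⟩ := h.exists_degree_eq hk hf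
    have h1 : (d : WithBot ℕ) + 1 ≤ e :=
      (add_le_add_left (hd ▸ le_max_left _ _) 1).trans hde
    have h2 : d + 1 ≤ e := by exact_mod_cast h1
    exact h.pencilSpan_mono H (by omega) (by omega) hd2
  obtain ⟨w, rfl⟩ := hmem
  obtain ⟨v, rfl⟩ := exists_restrict_eq w
  have hinj := h.upMap_injective H (i := e - 1) (k := k) (by omega) (by omega)
  have hinj' := h.upMap_injective (⊤ : L) (i := e) (k := k) (by omega) (by omega)
  have hup := h.upMap_extensionWeight hr he1 (k := k) (by omega) v
  refine ⟨⟨_, rfl, fun w hw => hinj hw⟩, ⟨_, hup, fun w hw => hinj' (hw.trans hup.symm)⟩,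
    fun E => ?_⟩
  rw [← hup, wt_upMap hinj, wt_upMap hinj']
  refine ⟨fun hE => ?_, fun hE => ?_⟩
  · rw [extensionWeight_of_le hE, ← sum_subspaces E.1 (e - 1) v]
    rfl
  · have h1 := h.rk_inf_add_one le_top hr le_top hE
    have h2 := E.2.2
    exact ⟨⟨E.1 ⊓ H, inf_le_right, by omega⟩, rfl, extensionWeight_of_not_le hE ..⟩

end IsGeometry

/-! ### The two geometries. -/

lemma isGeometry_finset (X : Type*) [DecidableEq X] : IsGeometry (Finset X) 1 where
  one_le := le_rfl
  rk_bot := card_empty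
  rk_lt := fun h => card_lt_card h
  rk_sup_add := fun a b => card_union_add_card_inter a b
  card_covers := by
    intro a b hab
    have h1 : {c : Finset X | a ≤ c ∧ c ≤ b ∧ rk c = rk a + 1} =
        (fun x => insert x a) '' ((b \ a : Finset X) : Set X) := by
      ext c
      simp only [Set.mem_ofPred_eq, Set.mem_image, mem_coe, mem_sdiff]
      constructor
      · rintro ⟨h1, h2, h3⟩
        obtain ⟨x, hx, rfl⟩ := (covBy_iff_exists_insert (s := a) (t := c)).1
          (covBy_iff_card_sdiff_eq_one.2 ⟨h1, by
            rw [card_sdiff_of_subset h1]; change #c = #a + 1 at h3; omega⟩)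
        exact ⟨x, ⟨h2 (mem_insert_self x a), hx⟩, rfl⟩
      · rintro ⟨x, ⟨hxb, hxa⟩, rfl⟩
        exact ⟨subset_insert x a, insert_subset hxb hab, card_insert_of_notMem hxa⟩
    have h2 : Set.InjOn (fun x => insert x a) ((b \ a : Finset X) : Set X) :=
      fun x hx y _ hxy => (insert_inj (mem_sdiff.1 hx).2).1 hxy
    have h3 : Nat.card {c : Finset X // a ≤ c ∧ c ≤ b ∧ rk c = rk a + 1} = #(b \ a) := by
      rw [← Set.ncard_coe_finset, ← h2.ncard_image, ← h1]
      rfl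
    rw [h3, card_sdiff_of_subset hab]
    simp [qNumber, rk]

lemma isGeometry_submodule (F V : Type*) [Field F] [Finite F] [AddCommGroup V] [Module F V]
    [Finite V] : IsGeometry (Submodule F V) (Nat.card F : ℝ) where
  one_le := by exact_mod_cast Nat.card_pos
  rk_bot := finrank_bot F V
  rk_lt := fun h => Submodule.finrank_lt_finrank_of_lt h
  rk_sup_add := fun a b => Submodule.finrank_sup_add_finrank_inf_eq a b
  card_covers := by
    classical
    intro A B hAB
    have := Fintype.ofFinite V
    have := Fintype.ofFinite (Submodule F V)
    have hq : (1 : ℝ) < Nat.card F := by exact_mod_cast Finite.one_lt_card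
    have hcard : ∀ U : Submodule F V, (#{x : V | x ∈ U} : ℝ) = (Nat.card F : ℝ) ^ rk U := by
      intro U
      rw [← Fintype.card_subtype, ← Nat.card_eq_fintype_card]
      exact_mod_cast Module.natCard_eq_pow_finrank (K := F) (V := U)
    have hdiff : ∀ U : Submodule F V, A ≤ U →
        (#{x : V | x ∈ U ∧ x ∉ A} : ℝ) = (Nat.card F : ℝ) ^ rk U - (Nat.card F : ℝ) ^ rk A := by
      intro U hU
      have h1 := card_filter_add_card_filter_not (s := {x : V | x ∈ U}) (fun x => x ∈ A)
      rw [filter_filter, filter_filter, filter_congr (q := fun x => x ∈ A)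
        (fun x _ => ⟨fun hx => hx.2, fun hx => ⟨hU hx, hx⟩⟩)] at h1
      rw [← hcard, ← hcard, ← h1]
      push_cast
      ring
    have hsup : ∀ x ∉ A, rk (A ⊔ Submodule.span F {x}) = rk A + 1 := by
      intro x hx
      have h1 := Submodule.finrank_sup_add_finrank_inf_eq A (Submodule.span F {x})
      have hx0 : x ≠ 0 := fun h0 => hx (h0 ▸ A.zero_mem)
      have hdisj : A ⊓ Submodule.span F {x} = ⊥ :=
        ((Submodule.disjoint_span_singleton' hx0).2 hx).eq_bot
      rwa [hdisj, finrank_bot, finrank_span_singleton hx0, add_zero] at h1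
    -- Count the vectors of `B` outside `A` by the cover `A ⊔ span {x}` they generate; each cover
    -- arises from `q ^ (rk A + 1) - q ^ rk A` vectors.
    have hcount := card_eq_sum_card_fiberwise (s := {x : V | x ∈ B ∧ x ∉ A})
      (t := {C : Submodule F V | A ≤ C ∧ C ≤ B ∧ rk C = rk A + 1})
      (f := fun x => A ⊔ Submodule.span F {x}) (by
        intro x hx
        simp only [coe_filter, Set.mem_ofPred_eq, mem_univ, true_and] at hx ⊢
        exact ⟨le_sup_left, sup_le hAB ((Submodule.span_singleton_le_iff_mem _ _).2 hx.1),
          hsup x hx.2⟩)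
    have hfib : ∀ C ∈ ({C : Submodule F V | A ≤ C ∧ C ≤ B ∧ rk C = rk A + 1} : Finset _),
        (#{x ∈ ({x : V | x ∈ B ∧ x ∉ A} : Finset V) | A ⊔ Submodule.span F {x} = C} : ℝ) =
          (Nat.card F : ℝ) ^ (rk A + 1) - (Nat.card F : ℝ) ^ rk A := by
      intro C hC
      simp only [mem_filter, mem_univ, true_and] at hC
      rw [← hC.2.2, ← hdiff C hC.1, filter_filter]
      congr 2
      ext x
      simp only [mem_filter, mem_univ, true_and]
      constructor
      · rintro ⟨⟨-, hx⟩, rfl⟩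
        exact ⟨le_sup_right (a := A) (Submodule.mem_span_singleton_self x), hx⟩
      · rintro ⟨hxC, hx⟩
        refine ⟨⟨hC.2.1 hxC, hx⟩, Submodule.eq_of_le_of_finrank_eq
          (sup_le hC.1 ((Submodule.span_singleton_le_iff_mem _ _).2 hxC)) ?_⟩
        exact (hsup x hx).trans hC.2.2.symm
    have hB := hdiff B hAB
    rw [hcount, Nat.cast_sum, sum_congr rfl hfib, sum_const, nsmul_eq_mul] at hB
    have hle : rk A ≤ rk B := Submodule.finrank_mono hAB
    rw [Nat.card_eq_fintype_card, Fintype.card_subtype, qNumber, geom_sum_eq hq.ne',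
      eq_div_iff (by linarith)]
    have hqa : (Nat.card F : ℝ) ^ rk A ≠ 0 := by positivity
    -- Multiplying by `q ^ rk A` turns the geometric sum identity into the vector count `hB`.
    refine mul_left_cancel₀ hqa ?_
    rw [mul_sub _ (_ ^ (rk B - rk A)), ← pow_add, Nat.add_sub_cancel' hle, mul_one, ← hB]
    ring

end

theorem theorem6p4 :
    -- the set case, `q = 1`
    (∀ (X : Type*) [Fintype X] [DecidableEq X] (n k : ℕ) (H : Finset X),
      Fintype.card X = n → 1 ≤ n → HasRk.rk H = n - 1 → k ≤ n - 1 →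
      IsLinearMap ℝ (extendByZero H k) ∧
      Function.Injective (extendByZero H k) ∧
      Set.range (extendByZero H k) =
        {g : Subspaces (⊤ : Finset X) k → ℝ | Function.support g ⊆ {K | K.1 ≤ H}} ∧
      (∀ f : Subspaces H k → ℝ,
        degree ⊤ (extendByZero H k f) = min (degree H f + 1) (k : WithBot ℕ)) ∧
      (∀ (f : Subspaces H k → ℝ) (e : ℕ),
        max (degree H f) 0 + 1 ≤ (e : WithBot ℕ) → e ≤ min k (n - k) →
          (∃! w, upMap H (e - 1) k w = f) ∧
          (∃! w, upMap ⊤ e k w = extendByZero H k f) ∧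
          ∀ E : Subspaces (⊤ : Finset X) e,
            (∀ h : E.1 ≤ H,
              wt ⊤ e (extendByZero H k f) E =
                1 / qNumber 1 (k - e + 1) *
                  ∑ E' : Subspaces E.1 (e - 1), wt H (e - 1) f (E'.incl h)) ∧
            (¬ E.1 ≤ H →
              ∃ E' : Subspaces H (e - 1), E'.1 = E.1 ⊓ H ∧
                wt ⊤ e (extendByZero H k f) E =
                  -(qNumber 1 (k - e) / (1 ^ (k - e) * qNumber 1 (k - e + 1))) *
                    wt H (e - 1) f E'))) ∧
    -- the vector space case, `q = #F`
    (∀ (F V : Type*) [Field F] [Finite F] [AddCommGroup V] [Module F V] [Finite V]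
      (q n k : ℕ) (H : Submodule F V),
      Nat.card F = q → Module.finrank F V = n → 1 ≤ n → HasRk.rk H = n - 1 → k ≤ n - 1 →
      IsLinearMap ℝ (extendByZero H k) ∧
      Function.Injective (extendByZero H k) ∧
      Set.range (extendByZero H k) =
        {g : Subspaces (⊤ : Submodule F V) k → ℝ | Function.support g ⊆ {K | K.1 ≤ H}} ∧
      (∀ f : Subspaces H k → ℝ,
        degree ⊤ (extendByZero H k f) = min (degree H f + 1) (k : WithBot ℕ)) ∧
      (∀ (f : Subspaces H k → ℝ) (e : ℕ),
        max (degree H f) 0 + 1 ≤ (e : WithBot ℕ) → e ≤ min k (n - k) →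
          (∃! w, upMap H (e - 1) k w = f) ∧
          (∃! w, upMap ⊤ e k w = extendByZero H k f) ∧
          ∀ E : Subspaces (⊤ : Submodule F V) e,
            (∀ h : E.1 ≤ H,
              wt ⊤ e (extendByZero H k f) E =
                1 / qNumber q (k - e + 1) *
                  ∑ E' : Subspaces E.1 (e - 1), wt H (e - 1) f (E'.incl h)) ∧
            (¬ E.1 ≤ H →
              ∃ E' : Subspaces H (e - 1), E'.1 = E.1 ⊓ H ∧
                wt ⊤ e (extendByZero H k f) E =
                  -(qNumber q (k - e) / ((q : ℝ) ^ (k - e) * qNumber q (k - e + 1))) *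
                    wt H (e - 1) f E'))) := by
  refine ⟨?_, ?_⟩
  · intro X _ _ n k H hX hn hH hk
    have htop : HasRk.rk (⊤ : Finset X) = n := Finset.card_univ.trans hX
    have hr : HasRk.rk (⊤ : Finset X) = HasRk.rk H + 1 := by omega
    have hkH : k ≤ HasRk.rk H := by omega
    subst htop
    exact ⟨isLinearMap_extendByZero H k, extendByZero_injective H k, range_extendByZero H k,
      (isGeometry_finset X).degree_extendByZero hr hkH,
      fun f e => (isGeometry_finset X).wt_extendByZero hr hkH f⟩
  · intro F V _ _ _ _ _ q n k H hq hV hn hH hk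
    have := Fintype.ofFinite (Submodule F V)
    have htop : HasRk.rk (⊤ : Submodule F V) = n := (finrank_top F V).trans hV
    have hr : HasRk.rk (⊤ : Submodule F V) = HasRk.rk H + 1 := by omega
    have hkH : k ≤ HasRk.rk H := by omega
    subst htop hq
    exact ⟨isLinearMap_extendByZero H k, extendByZero_injective H k, range_extendByZero H k,
      (isGeometry_submodule F V).degree_extendByZero hr hkH,
      fun f e => (isGeometry_submodule F V).wt_extendByZero hr hkH f⟩
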